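/- All digraphs are finite with nonempty vertex set. A digraph is simple if it has no loops and, for all vertices $x,y$, at most one edge from $x$ to $y$ (both $xy$ and $yx$ may be present). It is Eulerian if every vertex has equal in- and outdegree; this common value is the degree of the vertex, and connectedness is not required. Let $\vec{K}_t$ be the complete digraph on $t$ vertices, with exactly one edge from $x$ to $y$ for every ordered pair of distinct vertices $x,y$. A digraph $F$ without loops is (weakly) immersed in a digraph $D$ if there are an injective map $\varphi : V(F)\to V(D)$ and a family of pairwise edge-disjoint directed paths in $D$, one from $\varphi(u)$ to $\varphi(v)$ for every edge $uv$ of $F$; the paths may pass through vertices in the image of $\varphi$. Theorem. Let $t\ge 0$ be an integer. Every simple Eulerian digraph in which every vertex has degree at least $t(t-1)$ contains an immersion of $\vec{K}_t$. -/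

import Mathlib

/-- A digraph with vertex set `V` and edge set `E`; loops and parallel edges are allowed.
The edge `e` is directed from `src e` to `tgt e`. -/
structure MultiDigraph (V E : Type*) where
  /-- the initial vertex of an edge -/
  src : E → V
  /-- the terminal vertex of an edge -/
  tgt : E → V

namespace MultiDigraph

/-- No loops, and at most one edge from `x` to `y` for all vertices `x`, `y`
(oppositely oriented edges are allowed). -/
def IsSimple {V E : Type*} (D : MultiDigraph V E) : Prop :=
  (∀ e, D.src e ≠ D.tgt e) ∧
    ∀ e f, D.src e = D.src f → D.tgt e = D.tgt f → e = f

/-- The number of edges that start at `v`. -/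
noncomputable def outDegree {V E : Type*} (D : MultiDigraph V E) (v : V) : ℕ :=
  {e | D.src e = v}.ncard

/-- The number of edges that end at `v`. -/
noncomputable def inDegree {V E : Type*} (D : MultiDigraph V E) (v : V) : ℕ :=
  {e | D.tgt e = v}.ncard

/-- Every vertex has equal in- and outdegree. Connectedness is not required, so this covers
also the convention under which Eulerian digraphs are connected by definition. -/
def IsEulerian {V E : Type*} (D : MultiDigraph V E) : Prop :=
  ∀ v, D.inDegree v = D.outDegree v

/-- `D.IsDirectedWalk u v p`: the edges in the list `p`, in this order, form a directed walk
from `u` to `v`. -/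
def IsDirectedWalk {V E : Type*} (D : MultiDigraph V E) : V → V → List E → Prop
  | u, v, [] => u = v
  | u, v, e :: p => D.src e = u ∧ D.IsDirectedWalk (D.tgt e) v p

/-- A directed path from `u` to `v`: a directed walk whose vertices (`u`, followed by the terminal
vertices of its edges) are distinct. -/
def IsDirectedPath {V E : Type*} (D : MultiDigraph V E) (u v : V) (p : List E) : Prop :=
  D.IsDirectedWalk u v p ∧ (u :: p.map D.tgt).Nodup

/-- A directed cycle through `u`, traversed from `u` to `u`. -/
def IsDirectedCycle {V E : Type*} (D : MultiDigraph V E) (u : V) (p : List E) : Prop :=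
  p ≠ [] ∧ D.IsDirectedWalk u u p ∧ (p.map D.tgt).Nodup

/-- `F.IsImmersedIn D`: there are an injective map `φ` from the vertices of `F` to those of `D` and
pairwise edge-disjoint directed paths in `D`, one from `φ u` to `φ v` for every edge `uv` of `F`.
For a loop of `F` at `u`, the path is a directed cycle through `φ u`. Paths may pass through the
images of other vertices (weak immersion). -/
def IsImmersedIn {W A V E : Type*} (F : MultiDigraph W A) (D : MultiDigraph V E) : Prop :=
  ∃ (φ : W → V) (P : A → List E),
    Function.Injective φ ∧
    (∀ a, F.src a ≠ F.tgt a → D.IsDirectedPath (φ (F.src a)) (φ (F.tgt a)) (P a)) ∧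
    (∀ a, F.src a = F.tgt a → D.IsDirectedCycle (φ (F.src a)) (P a)) ∧
    ∀ a b, a ≠ b → List.Disjoint (P a) (P b)

/-- The complete digraph on `t` vertices: exactly one edge from `x` to `y` for each ordered pair of
distinct vertices `x`, `y`. -/
def complete (t : ℕ) : MultiDigraph (Fin t) {p : Fin t × Fin t // p.1 ≠ p.2} where
  src p := p.1.1
  tgt p := p.1.2

end MultiDigraph

/-!
The immersion is routed through a hub. Write `k = t * (t - 1)` and let `D.cut T` be the number of
edges leaving a vertex set `T`.

*A highly connected set.* In an Eulerian digraph the function `cut` is symmetric under complements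
and submodular, hence posimodular. Uncrossing, as in the construction of a Gomory–Hu tree, gives a
nonempty set `A` which is either the whole vertex set or has `cut A < k`, and such that every vertex
set which separates two vertices of `A` has at least `k` leaving edges (`exists_unsplit_set`). Since
the digraph is simple and the degrees are at least `k`, counting the edges that start in `A` shows
that `A` has more than `k` vertices (`lt_card_of_cut`). For `2 ≤ t` there is room in `A` for the `t`
branch vertices and one further vertex `h`, the hub.

*Routing.* The digraph `complete t` has `k` edges. As every set containing a branch vertex but
not `h` has at least `k` leaving edges, augmenting along residual paths yields a set `F` of edges
which is a flow sending to `h`, from each branch vertex, one unit for each edge of `complete t`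
starting there (`exists_flow`). The digraph is Eulerian, so the complement of `F` is a flow in the
opposite direction: it sends the same amounts from `h` to the branch vertices. Every branch vertex
has as many outgoing as incoming edges in `complete t`, so both flows decompose into families of
edge-disjoint walks indexed by the edges of `complete t` (`exists_walks_of_boundary`), and
the walk to `h` followed by the walk from `h`, shortcut to a path, serves the edge in question.
-/

open Finset

namespace MultiDigraph

variable {V E : Type*} (D : MultiDigraph V E)

/-! ### Directed walks -/

section Walks

variable {D}

theorem IsDirectedWalk.append {p q : List E} {u v w : V} (hp : D.IsDirectedWalk u v p)
    (hq : D.IsDirectedWalk v w q) : D.IsDirectedWalk u w (p ++ q) := by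
  induction p generalizing u with
  | nil => cases hp; exact hq
  | cons e p ih => exact ⟨hp.1, ih hp.2⟩

theorem IsDirectedPath.exists_suffix {p : List E} {u v w : V} (hp : D.IsDirectedPath u v p)
    (hw : w ∈ u :: p.map D.tgt) : ∃ q, D.IsDirectedPath w v q ∧ q ⊆ p := by
  induction p generalizing u with
  | nil =>
    obtain rfl : w = u := by simpa using hw
    exact ⟨[], hp, List.Subset.refl _⟩
  | cons e p ih =>
    rcases List.mem_cons.1 hw with rfl | hw
    · exact ⟨e :: p, hp, List.Subset.refl _⟩
    · obtain ⟨q, hq, hqp⟩ := ih (u := D.tgt e) ⟨hp.1.2, (List.nodup_cons.1 hp.2).2⟩ hw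
      exact ⟨q, hq, fun x hx => List.mem_cons_of_mem _ (hqp hx)⟩

theorem IsDirectedWalk.exists_path {p : List E} {u v : V} (hp : D.IsDirectedWalk u v p) :
    ∃ q, D.IsDirectedPath u v q ∧ q ⊆ p := by
  induction p generalizing u with
  | nil => exact ⟨[], ⟨hp, by simp⟩, List.Subset.refl _⟩
  | cons e p ih =>
    obtain ⟨q, hq, hqp⟩ := ih hp.2
    by_cases hu : u ∈ D.tgt e :: q.map D.tgt
    · obtain ⟨r, hr, hrq⟩ := hq.exists_suffix hu
      exact ⟨r, hr, fun x hx => List.mem_cons_of_mem _ (hqp (hrq hx))⟩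
    · exact ⟨e :: q, ⟨⟨hp.1, hq.1⟩, List.nodup_cons.2 ⟨hu, hq.2⟩⟩, List.cons_subset_cons _ hqp⟩

theorem IsDirectedPath.nodup {p : List E} {u v : V} (hp : D.IsDirectedPath u v p) : p.Nodup :=
  (List.nodup_cons.1 hp.2).2.of_map _

end Walks

/-- The digraph with all edges reversed. -/
def reverse : MultiDigraph V E where
  src := D.tgt
  tgt := D.src

theorem IsDirectedWalk.of_reverse {D : MultiDigraph V E} {p : List E} {u v : V}
    (hp : D.reverse.IsDirectedWalk u v p) : D.IsDirectedWalk v u p.reverse := by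
  induction p generalizing u with
  | nil => exact (show u = v from hp).symm
  | cons e p ih =>
    rw [List.reverse_cons]
    exact (ih hp.2).append ⟨rfl, hp.1⟩

/-! ### Boundaries of edge sets -/

section Boundary

variable [DecidableEq V]

/-- The boundary of a set of edges, as a `0`-chain: its value at `v` is the number of edges of `F`
that start at `v` minus the number of those that end at `v`. -/
def boundary (F : Finset E) : V → ℤ :=
  ∑ e ∈ F, (Pi.single (D.src e) 1 - Pi.single (D.tgt e) 1)

theorem boundary_reverse (F : Finset E) : D.reverse.boundary F = -D.boundary F := by
  simp only [boundary, ← Finset.sum_neg_distrib, neg_sub]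
  rfl

theorem sum_boundary (F : Finset E) (R : Finset V) :
    ∑ v ∈ R, D.boundary F v =
      ∑ e ∈ F, ((if D.src e ∈ R then 1 else 0) - (if D.tgt e ∈ R then 1 else 0)) := by
  simp only [boundary, Finset.sum_apply, Pi.sub_apply]
  rw [Finset.sum_comm]
  refine Finset.sum_congr rfl fun e _ => ?_
  simp [Finset.sum_sub_distrib, Pi.single_apply]

variable [DecidableEq E]

theorem boundary_sdiff {F G : Finset E} (h : G ⊆ F) :
    D.boundary (F \ G) = D.boundary F - D.boundary G :=
  Finset.sum_sdiff_eq_sub h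

variable {D} in
theorem IsDirectedWalk.boundary_eq {p : List E} {u v : V} (hp : D.IsDirectedWalk u v p)
    (hn : p.Nodup) : D.boundary p.toFinset = Pi.single u 1 - Pi.single v 1 := by
  induction p generalizing u with
  | nil => cases hp; simp [boundary]
  | cons e p ih =>
    obtain ⟨he, hn⟩ := List.nodup_cons.1 hn
    have h := ih hp.2 hn
    rw [boundary] at h ⊢
    rw [List.toFinset_cons, Finset.sum_insert (by simpa using he), h, hp.1]
    abel

/-- The vertices reachable from `u` along edges of `F` form a set which no edge of `F` leaves; so
its total boundary is nonpositive, and it contains a sink of `F` if `u` is a source. -/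
theorem exists_path_of_boundary_pos [Fintype V] (F : Finset E) (u : V) (hu : 0 < D.boundary F u) :
    ∃ v p, D.boundary F v < 0 ∧ D.IsDirectedPath u v p ∧ p.toFinset ⊆ F := by
  classical
  let R : Finset V := {v | ∃ p : List E, D.IsDirectedWalk u v p ∧ p.toFinset ⊆ F}
  have huR : u ∈ R := by simpa [R] using ⟨[], rfl, by simp⟩
  have hclosed : ∀ e ∈ F, D.src e ∈ R → D.tgt e ∈ R := by
    intro e he hs
    obtain ⟨p, hp, hpF⟩ := (Finset.mem_filter.1 hs).2
    refine Finset.mem_filter.2 ⟨Finset.mem_univ _, p ++ [e], hp.append ⟨rfl, rfl⟩, ?_⟩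
    rw [List.toFinset_append]
    exact Finset.union_subset hpF (by simpa using he)
  have hle : ∑ v ∈ R, D.boundary F v ≤ 0 := by
    rw [sum_boundary]
    refine Finset.sum_nonpos fun e he => ?_
    have := hclosed e he
    split_ifs <;> simp_all
  obtain ⟨v, hv, hneg⟩ : ∃ v ∈ R, D.boundary F v < 0 := by
    by_contra! hcon
    exact absurd hle (not_le.2 (Finset.sum_pos' hcon ⟨u, huR, hu⟩))
  obtain ⟨p, hp, hpF⟩ := (Finset.mem_filter.1 hv).2
  obtain ⟨q, hq, hqp⟩ := hp.exists_path
  exact ⟨v, q, hneg, hq, fun e he => hpF (by simpa using hqp (by simpa using he))⟩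

/-- A flow towards a single sink `h` decomposes into edge-disjoint walks to `h`. -/
theorem exists_walks_of_boundary [Fintype V] {J : Type*} [DecidableEq J] (s : J → V) (h : V)
    (hs : ∀ j, s j ≠ h) (K : Finset J) (F : Finset E)
    (hF : D.boundary F = ∑ j ∈ K, (Pi.single (s j) 1 - Pi.single h 1)) :
    ∃ P : J → List E, (∀ j ∈ K, D.IsDirectedWalk (s j) h (P j) ∧ (P j).toFinset ⊆ F) ∧
      ∀ i ∈ K, ∀ j ∈ K, i ≠ j → List.Disjoint (P i) (P j) := by
  induction K using Finset.induction_on generalizing F with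
  | empty => exact ⟨fun _ => [], by simp, by simp⟩
  | insert j K hj ih =>
    have hval : ∀ v ≠ h, D.boundary F v = #{i ∈ insert j K | s i = v} := by
      intro v hv
      rw [hF, Finset.sum_apply]
      simp [Pi.single_apply, hv, eq_comm]
    have hpos : 0 < D.boundary F (s j) := by
      rw [hval _ (hs j)]
      exact_mod_cast Finset.card_pos.2 ⟨j, by simp⟩
    obtain ⟨v, p, hv, hp, hpF⟩ := D.exists_path_of_boundary_pos F (s j) hpos
    -- the boundary is negative only at `h`
    obtain rfl : v = h := by
      by_contra hne
      rw [hval v hne] at hv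
      exact absurd hv (by simp)
    have hrest : D.boundary (F \ p.toFinset) =
        ∑ j ∈ K, (Pi.single (s j) 1 - Pi.single v 1) := by
      rw [D.boundary_sdiff hpF, hp.1.boundary_eq hp.nodup, hF, Finset.sum_insert hj,
        add_sub_cancel_left]
    obtain ⟨P, hP, hdisj⟩ := ih _ hrest
    have hnew : ∀ i ∈ K, List.Disjoint p (P i) := fun i hi e hep hei =>
      (Finset.mem_sdiff.1 ((hP i hi).2 (by simpa using hei))).2 (by simpa using hep)
    have hupd : ∀ i ∈ K, Function.update P j p i = P i := fun i hi =>
      Function.update_of_ne (by rintro rfl; exact hj hi) _ _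
    refine ⟨Function.update P j p, ?_, ?_⟩
    · intro i hi
      rcases Finset.mem_insert.1 hi with rfl | hi
      · simpa using ⟨hp.1, hpF⟩
      · rw [hupd i hi]
        exact ⟨(hP i hi).1, (hP i hi).2.trans Finset.sdiff_subset⟩
    · intro i hi i' hi' hne
      rcases Finset.mem_insert.1 hi with rfl | h1 <;>
        rcases Finset.mem_insert.1 hi' with rfl | h2
      · exact absurd rfl hne
      · simpa [hupd i' h2] using hnew i' h2
      · simpa [hupd i h1] using (hnew i h1).symm
      · simpa [hupd i h1, hupd i' h2] using hdisj i h1 i' h2 hne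

/-! ### Augmenting paths -/

/-- The residual digraph of the flow `F`: the edges of `F` are reversed, the others are kept. -/
def residual (F : Finset E) : MultiDigraph V E where
  src e := if e ∈ F then D.tgt e else D.src e
  tgt e := if e ∈ F then D.src e else D.tgt e

theorem boundary_symmDiff [Fintype E] (F Q : Finset E) :
    D.boundary (symmDiff F Q) = D.boundary F + (D.residual F).boundary Q := by
  have key : ∀ (D' : MultiDigraph V E) (G : Finset E), D'.boundary G =
      ∑ e, if e ∈ G then Pi.single (D'.src e) (1 : ℤ) - Pi.single (D'.tgt e) 1 else 0 := by
    intro D' G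
    simp [boundary]
  rw [key, key, key, ← Finset.sum_add_distrib]
  refine Finset.sum_congr rfl fun e _ => ?_
  by_cases h1 : e ∈ F <;> by_cases h2 : e ∈ Q <;>
    simp [h1, h2, Finset.mem_symmDiff, residual]

/-- The number of edges that leave the vertex set `T`. -/
def cut [Fintype E] (T : Finset V) : ℕ :=
  #{e | D.src e ∈ T ∧ D.tgt e ∉ T}

/-- Integral max-flow min-cut for unit capacities and the single sink `h`, where a flow is the set
of edges carrying one unit, and the sources are the `s j`. -/
theorem exists_flow [Fintype V] [Fintype E] {J : Type*} [DecidableEq J] (s : J → V) (h : V)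
    (K : Finset J) (hcut : ∀ R : Finset V, h ∉ R → #{j ∈ K | s j ∈ R} ≤ D.cut R) :
    ∃ F : Finset E, D.boundary F = ∑ j ∈ K, (Pi.single (s j) 1 - Pi.single h 1) := by
  classical
  induction K using Finset.induction_on with
  | empty => exact ⟨∅, by simp [boundary]⟩
  | insert j K hj ih =>
    obtain ⟨F, hF⟩ := ih fun R hR => (Finset.card_le_card
      (Finset.filter_subset_filter _ (Finset.subset_insert j K))).trans (hcut R hR)
    let R : Finset V := {v | ∃ p : List E, (D.residual F).IsDirectedWalk (s j) v p}
    have hjR : s j ∈ R := by simpa [R] using ⟨[], rfl⟩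
    have hclosed : ∀ e, (D.residual F).src e ∈ R → (D.residual F).tgt e ∈ R := by
      intro e hs
      obtain ⟨p, hp⟩ := (Finset.mem_filter.1 hs).2
      exact Finset.mem_filter.2 ⟨Finset.mem_univ _, p ++ [e], hp.append ⟨rfl, rfl⟩⟩
    have hhR : h ∈ R := by
      by_contra hh
      -- `F` contains all edges leaving `R` and no edge entering it, so `R` violates `hcut`
      have h1 : ∑ v ∈ R, D.boundary F v = D.cut R := by
        rw [sum_boundary, cut, Finset.card_filter, Nat.cast_sum,
          ← Finset.sum_subset (Finset.subset_univ F)]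
        · refine Finset.sum_congr rfl fun e he => ?_
          have := hclosed e
          simp only [residual, he, if_true] at this
          by_cases hs : D.src e ∈ R <;> by_cases ht : D.tgt e ∈ R <;> simp_all
        · intro e _ he
          have := hclosed e
          simp only [residual, he, if_false] at this
          simpa using this
      have h2 : ∑ v ∈ R, D.boundary F v = #{i ∈ K | s i ∈ R} := by
        rw [hF]
        simp only [Finset.sum_apply, Pi.sub_apply]
        rw [Finset.sum_comm, Finset.card_filter, Nat.cast_sum]
        refine Finset.sum_congr rfl fun i _ => ?_
        simp [Finset.sum_sub_distrib, Pi.single_apply, hh]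
      have h3 := hcut R hh
      rw [Finset.filter_insert, if_pos hjR, Finset.card_insert_of_notMem (by simp [hj])] at h3
      omega
    obtain ⟨p, hp⟩ := (Finset.mem_filter.1 hhR).2
    obtain ⟨q, hq, -⟩ := hp.exists_path
    refine ⟨symmDiff F q.toFinset, ?_⟩
    rw [boundary_symmDiff, hq.1.boundary_eq hq.nodup, hF, Finset.sum_insert hj, add_comm]

end Boundary

/-! ### Edge cuts in Eulerian digraphs -/

section Cuts

variable [DecidableEq V] [Fintype E]

theorem outDegree_eq_card (v : V) : D.outDegree v = #{e | D.src e = v} := by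
  rw [outDegree, ← Set.ncard_coe_finset]
  simp

variable {D}

theorem IsEulerian.boundary_univ (hD : D.IsEulerian) : D.boundary Finset.univ = 0 := by
  funext v
  have hout := D.outDegree_eq_card v
  have hin : D.inDegree v = #{e | D.tgt e = v} := D.reverse.outDegree_eq_card v
  have := hD v
  rw [hin, hout] at this
  simp only [boundary, Finset.sum_apply, Pi.sub_apply, Pi.single_apply, Finset.sum_sub_distrib,
    Pi.zero_apply, eq_comm (a := v), Finset.sum_boole, this, sub_self]

theorem IsEulerian.cut_compl [Fintype V] (hD : D.IsEulerian) (T : Finset V) :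
    D.cut Tᶜ = D.cut T := by
  have h := D.sum_boundary Finset.univ T
  rw [hD.boundary_univ] at h
  have key : ((D.cut T : ℤ) - D.cut Tᶜ) =
      ∑ e, ((if D.src e ∈ T then 1 else 0) - (if D.tgt e ∈ T then 1 else 0)) := by
    rw [cut, cut, Finset.card_filter, Finset.card_filter, Nat.cast_sum, Nat.cast_sum,
      ← Finset.sum_sub_distrib]
    refine Finset.sum_congr rfl fun e _ => ?_
    by_cases hs : D.src e ∈ T <;> by_cases ht : D.tgt e ∈ T <;> simp [hs, ht]
  rw [← key] at h
  simp only [Pi.zero_apply, Finset.sum_const_zero] at h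
  omega

/-- Posimodularity of the cut function; it follows from submodularity and symmetry. -/
theorem IsEulerian.cut_sdiff_add_cut_sdiff_le [Fintype V] (hD : D.IsEulerian) (S T : Finset V) :
    D.cut (S \ T) + D.cut (T \ S) ≤ D.cut S + D.cut T := by
  rw [← hD.cut_compl (T \ S), ← hD.cut_compl T]
  simp only [cut, Finset.card_filter, ← Finset.sum_add_distrib]
  refine Finset.sum_le_sum fun e _ => ?_
  by_cases hs : D.src e ∈ S <;> by_cases hs' : D.src e ∈ T <;>
    by_cases ht : D.tgt e ∈ S <;> by_cases ht' : D.tgt e ∈ T <;> simp [hs, hs', ht, ht']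

/-- There is a vertex set `A`, of small cut unless it is everything, which no small cut splits.
It plays the role of a leaf of a Gomory–Hu tree whose light edges have been removed. -/
theorem IsEulerian.exists_unsplit_set [Fintype V] [Nonempty V] (hD : D.IsEulerian) (k : ℕ) :
    ∃ A : Finset V, A.Nonempty ∧ (A = Finset.univ ∨ D.cut A < k) ∧
      ∀ T : Finset V, (T ∩ A).Nonempty → (A \ T).Nonempty → k ≤ D.cut T := by
  -- `Q A`: a cut splitting `A` can be replaced by one that is no larger, splits `A` in the same
  -- way and has one side inside `A`. The set sought is a minimal one with this property.
  let Q : Finset V → Prop := fun A => ∀ T : Finset V, (T ∩ A).Nonempty → (A \ T).Nonempty →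
    D.cut (T ∩ A) ≤ D.cut T ∨ D.cut (A \ T) ≤ D.cut T
  obtain ⟨A, ⟨hne, hsmall, hQ⟩, hmin⟩ := WellFounded.has_min (wellFounded_lt (α := Finset V))
    {A | A.Nonempty ∧ (A = Finset.univ ∨ D.cut A < k) ∧ Q A}
    ⟨Finset.univ, Finset.univ_nonempty, Or.inl rfl, fun T _ _ => Or.inl (by simp)⟩
  refine ⟨A, hne, hsmall, fun T hT1 hT2 => ?_⟩
  by_contra! hT
  obtain ⟨B₀, hB₀, hB₀k⟩ :
      ∃ B ∈ A.ssubsets.filter (fun B : Finset V => B.Nonempty), D.cut B < k := by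
    rcases hQ T hT1 hT2 with h | h
    · refine ⟨T ∩ A, ?_, h.trans_lt hT⟩
      rw [Finset.mem_filter, Finset.mem_ssubsets, Finset.ssubset_iff_subset_ne]
      refine ⟨⟨Finset.inter_subset_right, fun heq => ?_⟩, hT1⟩
      obtain ⟨x, hx⟩ := hT2
      rw [← heq] at hx
      simp at hx
      tauto
    · refine ⟨A \ T, ?_, h.trans_lt hT⟩
      rw [Finset.mem_filter, Finset.mem_ssubsets, Finset.ssubset_iff_subset_ne]
      refine ⟨⟨Finset.sdiff_subset, fun heq => ?_⟩, hT2⟩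
      obtain ⟨x, hx⟩ := hT1
      rw [← heq] at hx
      simp at hx
  -- a smallest cut inside `A` inherits `Q`, which contradicts the minimality of `A`
  obtain ⟨B, hB, hBmin⟩ := Finset.exists_min_image _ D.cut ⟨B₀, hB₀⟩
  have hBk : D.cut B < k := (hBmin B₀ hB₀).trans_lt hB₀k
  rw [Finset.mem_filter, Finset.mem_ssubsets] at hB
  obtain ⟨hBA, hBne⟩ := hB
  refine hmin B ⟨hBne, Or.inr hBk, fun U hU1 hU2 => ?_⟩ hBA
  have inner : ∀ W ⊆ A, (B \ W).Nonempty → D.cut (W ∩ B) ≤ D.cut W ∨ D.cut (B \ W) ≤ D.cut W := by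
    intro W hWA hW
    rcases (W \ B).eq_empty_or_nonempty with h | h
    · left
      rw [Finset.inter_eq_left.2 (Finset.sdiff_eq_empty_iff_subset.1 h)]
    · right
      have h1 : D.cut B ≤ D.cut (W \ B) := by
        refine hBmin _ (Finset.mem_filter.2 ⟨Finset.mem_ssubsets.2 ?_, h⟩)
        refine Finset.ssubset_iff_subset_ne.2 ⟨Finset.sdiff_subset.trans hWA, fun heq => ?_⟩
        obtain ⟨x, hx⟩ := hBne
        have := hBA.1 hx
        rw [← heq] at this
        exact (Finset.mem_sdiff.1 this).2 hx
      have h2 := hD.cut_sdiff_add_cut_sdiff_le W B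
      omega
  have hi : (U ∩ A) ∩ B = U ∩ B := by
    rw [Finset.inter_assoc, Finset.inter_eq_right.2 hBA.1]
  have hd : B \ (U ∩ A) = B \ U := by
    ext x; have := @hBA.1 x; simp; tauto
  have hi' : (A \ U) ∩ B = B \ U := by
    ext x; have := @hBA.1 x; simp; tauto
  have hd' : B \ (A \ U) = U ∩ B := by
    ext x; have := @hBA.1 x; simp; tauto
  rcases hQ U (hU1.mono (Finset.inter_subset_inter_left hBA.1))
    (hU2.mono (Finset.sdiff_subset_sdiff hBA.1 le_rfl)) with h | h
  · have := inner _ Finset.inter_subset_right (hd ▸ hU2)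
    rw [hi, hd] at this
    exact this.imp h.trans' h.trans'
  · have := inner _ Finset.sdiff_subset (hd' ▸ hU1)
    rw [hi', hd'] at this
    exact (this.imp h.trans' h.trans').symm

/-- Fewer than `#A` edges inside `A` start at each vertex of `A`, so if `#A ≤ k` then at
least `#A * (k + 1 - #A) ≥ k > 0` edges leave `A`, in contradiction to `hA`. -/
theorem IsSimple.lt_card_of_cut [Fintype V] (hD : D.IsSimple) (k : ℕ)
    (hdeg : ∀ v, k ≤ D.outDegree v) (A : Finset V) (hne : A.Nonempty)
    (hA : A = Finset.univ ∨ D.cut A < k) : k < #A := by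
  have hsum : #A * k ≤ #{e | D.src e ∈ A} := by
    rw [Finset.card_eq_sum_card_fiberwise (s := {e | D.src e ∈ A}) (t := A) (f := D.src)
      (fun e he => by simpa using he), ← smul_eq_mul]
    refine Finset.card_nsmul_le_sum _ _ _ fun v hv => ?_
    refine (hdeg v).trans ?_
    rw [D.outDegree_eq_card]
    refine Finset.card_le_card fun e he => ?_
    simp_all
  have hsplit : #{e | D.src e ∈ A} = #{e | D.src e ∈ A ∧ D.tgt e ∈ A} + D.cut A := by
    rw [cut, ← Finset.filter_filter, ← Finset.filter_filter,
      Finset.card_filter_add_card_filter_not]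
  have hins : #{e | D.src e ∈ A ∧ D.tgt e ∈ A} ≤ #A * #A - #A := by
    rw [← Finset.offDiag_card]
    refine Finset.card_le_card_of_injOn (fun e => (D.src e, D.tgt e)) ?_ ?_
    · intro e he
      have := hD.1 e
      simp_all
    · intro e _ f _ hef
      exact hD.2 e f (congrArg Prod.fst hef) (congrArg Prod.snd hef)
  have hpos := hne.card_pos
  have hcut : D.cut A = 0 ∨ D.cut A < k := by
    refine hA.imp_left fun h => ?_
    simp [h, cut]
  by_contra! hle
  obtain ⟨n, hn⟩ : ∃ n, #A = n + 1 := ⟨#A - 1, by omega⟩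
  have hins' : #A * #A - #A = (n + 1) * n := by
    rw [hn, Nat.mul_succ, Nat.add_sub_cancel]
  rw [hins'] at hins
  rw [hn] at hsum hle
  rcases hcut with h | h <;> nlinarith

end Cuts

/-! ### Routing through a hub -/

/-- Immersion through a hub `h` of a balanced loopless digraph `F` (`hbal` says that each vertex
of `F` is as often a source as a target): the path for an edge `uv` of `F` is cut out of a walk
from `φ u` to `h` followed by one from `h` to `φ v`. -/
theorem IsEulerian.isImmersedIn_of_hub [Fintype V] [Fintype E] [DecidableEq V] [DecidableEq E]
    {D : MultiDigraph V E} (hD : D.IsEulerian) {W A : Type*} [Fintype A] [DecidableEq A]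
    (F : MultiDigraph W A) (hloop : ∀ a, F.src a ≠ F.tgt a)
    (hbal : ∀ f : W → V → ℤ, ∑ a, f (F.src a) = ∑ a, f (F.tgt a))
    (φ : W → V) (hφ : Function.Injective φ) (h : V) (hh : ∀ w, φ w ≠ h)
    (hcut : ∀ (R : Finset V) (w : W), h ∉ R → φ w ∈ R → Fintype.card A ≤ D.cut R) :
    F.IsImmersedIn D := by
  obtain ⟨G, hG⟩ := D.exists_flow (fun a => φ (F.src a)) h Finset.univ fun R hR => by
    rcases ({a | φ (F.src a) ∈ R} : Finset A).eq_empty_or_nonempty with h0 | ⟨a, ha⟩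
    · rw [h0]
      exact Nat.zero_le _
    · exact (Finset.card_le_univ _).trans (hcut R _ hR (Finset.mem_filter.1 ha).2)
  -- the complement of `G`, reversed, is again a flow to `h`, of which each branch vertex
  -- supplies as many units as there are edges of `F` ending there
  have hGc : D.reverse.boundary Gᶜ =
      ∑ a, (Pi.single (φ (F.tgt a)) 1 - Pi.single h 1) := by
    rw [boundary_reverse, Finset.compl_eq_univ_sdiff, D.boundary_sdiff (Finset.subset_univ _),
      hD.boundary_univ, zero_sub, neg_neg, hG]
    exact hbal fun w => Pi.single (φ w) 1 - Pi.single h 1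
  obtain ⟨P, hP, hPd⟩ := D.exists_walks_of_boundary _ h (fun a => hh (F.src a)) _ G hG
  obtain ⟨P', hP', hPd'⟩ :=
    D.reverse.exists_walks_of_boundary _ h (fun a => hh (F.tgt a)) _ Gᶜ hGc
  have hwalk : ∀ a, D.IsDirectedWalk (φ (F.src a)) (φ (F.tgt a)) (P a ++ (P' a).reverse) :=
    fun a => (hP a (Finset.mem_univ a)).1.append (hP' a (Finset.mem_univ a)).1.of_reverse
  choose q hq hqsub using fun a => (hwalk a).exists_path
  have hcross : ∀ a b e, e ∈ P a → e ∉ P' b := fun a b e he he' =>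
    Finset.mem_compl.1 ((hP' b (Finset.mem_univ b)).2 (List.mem_toFinset.2 he'))
      ((hP a (Finset.mem_univ a)).2 (List.mem_toFinset.2 he))
  refine ⟨φ, q, hφ, fun a _ => hq a, fun a ha => absurd ha (hloop a), fun a b hab e hea heb => ?_⟩
  have ha := hqsub a hea
  have hb := hqsub b heb
  rw [List.mem_append, List.mem_reverse] at ha hb
  rcases ha with ha | ha <;> rcases hb with hb | hb
  · exact hPd a (Finset.mem_univ a) b (Finset.mem_univ b) hab ha hb
  · exact hcross a b e ha hb
  · exact hcross b a e hb ha
  · exact hPd' a (Finset.mem_univ a) b (Finset.mem_univ b) hab ha hb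

theorem card_edges_complete (t : ℕ) :
    Fintype.card {p : Fin t × Fin t // p.1 ≠ p.2} = t * (t - 1) := by
  have h : ({p | p.1 ≠ p.2} : Finset (Fin t × Fin t)) = (Finset.univ : Finset (Fin t)).offDiag := by
    ext p
    simp
  rw [Fintype.card_subtype, h, Finset.offDiag_card, Finset.card_univ, Fintype.card_fin,
    Nat.mul_sub_one]

theorem sum_src_complete {M : Type*} [AddCommMonoid M] (t : ℕ) (f : Fin t → M) :
    ∑ a, f ((complete t).src a) = ∑ a, f ((complete t).tgt a) :=
  Fintype.sum_equiv ((Equiv.prodComm _ _).subtypeEquiv fun _ => ne_comm) _ _ fun _ => rfl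

end MultiDigraph

theorem mainTheorem1 {V E : Type*} [Finite V] [Nonempty V] [Finite E]
    (D : MultiDigraph V E) (hsimple : D.IsSimple) (heulerian : D.IsEulerian)
    (t : ℕ) (hdeg : ∀ v, t * (t - 1) ≤ D.outDegree v) :
    (MultiDigraph.complete t).IsImmersedIn D := by
  classical
  have := Fintype.ofFinite V
  have := Fintype.ofFinite E
  rcases Nat.lt_or_ge t 2 with ht | ht
  · -- there are no edges, and in the case `t = 1` the set `A` below might have no room for a hub
    have : Subsingleton (Fin t) := Fin.subsingleton_iff_le_one.2 (by omega)
    have hA : ∀ a : {p : Fin t × Fin t // p.1 ≠ p.2}, False :=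
      fun a => a.2 (Subsingleton.elim _ _)
    exact ⟨fun _ => Classical.arbitrary V, fun _ => [], fun _ _ _ => Subsingleton.elim _ _,
      fun a => (hA a).elim, fun a => (hA a).elim, fun a => (hA a).elim⟩
  obtain ⟨A, hne, hA, hunsplit⟩ := heulerian.exists_unsplit_set (t * (t - 1))
  have hcard := hsimple.lt_card_of_cut _ hdeg A hne hA
  obtain ⟨h, hhA⟩ := hne
  have hroom : Fintype.card (Fin t) ≤ Fintype.card (A.erase h) := by
    rw [Fintype.card_fin, Fintype.card_coe, Finset.card_erase_of_mem hhA]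
    have : t * 1 ≤ t * (t - 1) := Nat.mul_le_mul_left t (by omega)
    omega
  obtain ⟨ψ⟩ := Function.Embedding.nonempty_of_card_le hroom
  refine heulerian.isImmersedIn_of_hub _ (fun a => a.2)
    (fun f => MultiDigraph.sum_src_complete t f) (fun i => (ψ i : V))
    (Subtype.val_injective.comp ψ.injective) h
    (fun i => (Finset.mem_erase.1 (ψ i).2).1) fun R i hR hi => ?_
  rw [MultiDigraph.card_edges_complete]
  exact hunsplit R ⟨ψ i, Finset.mem_inter.2 ⟨hi, (Finset.mem_erase.1 (ψ i).2).2⟩⟩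
    ⟨h, Finset.mem_sdiff.2 ⟨hhA, hR⟩⟩
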